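/- Let $\mathbb{H}$ be the division ring of real quaternions, with real part $\mathrm{Re}$, conjugation $q \mapsto \overline{q}$ and modulus $|q| = \sqrt{q\overline{q}}$, and let $\mathbb{H}[x]$ be the ring of polynomials over $\mathbb{H}$ in which the variable $x$ commutes with the coefficients (the skew polynomial ring $\mathbb{H}[x;\sigma,\delta]$ with $\sigma = \mathrm{Id}$ and $\delta = 0$). An element $b \in \mathbb{H}$ is a (right) zero of $F \in \mathbb{H}[x]$ if the remainder of $F$ on right division by $x - b$ is zero, that is, if $F = G\,(x-b)$ for some $G \in \mathbb{H}[x]$. For an integer $r \geq 1$, a vector $(a_1, a_2, \ldots, a_r) \in \mathbb{H}^r$ is called a multiplicity sequence if $a_1$ is the only zero of $$ P_{\mathbf{a}} = (x-a_r) \cdots (x-a_2)(x-a_1) $$ in $\mathbb{H}$. Then, for every integer $r \geq 1$: 1. A vector $(a_1, a_2, \ldots, a_r) \in \mathbb{H}^r$ is a multiplicity sequence if, and only if, either $a_1 = a_2 = \cdots = a_r \in \mathbb{R}$, or $a_1, a_2, \ldots, a_r \in \mathbb{H} \setminus \mathbb{R}$ and, for $i = 1, 2, \ldots, r-1$, $$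 \mathrm{Re}(a_{i+1}) = \mathrm{Re}(a_i), \quad |a_{i+1}| = |a_i|, \quad \text{and} \quad \overline{a}_{i+1} \neq a_i . $$ 2. In particular, for every $a \in \mathbb{H}$, the constant vector $(a, a, \ldots, a) \in \mathbb{H}^r$ is a multiplicity sequence. -/

import Mathlib

open Polynomial

/-!
Polynomials over a (not necessarily commutative) division ring `F` in which the variable commutes
with the coefficients, i.e. the skew polynomial ring `F[x; Id, 0]`.  In Mathlib's `F[X]` over a
noncommutative `F` one has `X * C a = C a * X`, while `C : F → F[X]` is multiplicative.
-/

/-- `R` is the remainder of the Euclidean division of `A` by `P` on the right: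
`A = G * P + R` with `deg R < deg P`. -/
def IsRightRemainder {F : Type*} [DivisionRing F] (A P R : F[X]) : Prop :=
  R.degree < P.degree ∧ ∃ G : F[X], A = G * P + R

/-- `b` is a (right) zero of `A`: the remainder of `A` on right division by `x - b` is zero. -/
def IsRightZero {F : Type*} [DivisionRing F] (A : F[X]) (b : F) : Prop :=
  IsRightRemainder A (X - C b) 0

/-- For `a = (a₁, …, a_r)`, the polynomial `(x - a_r) ⋯ (x - a₂) (x - a₁)`. -/
noncomputable def linearProduct {F : Type*} [DivisionRing F] {r : ℕ} (a : Fin r → F) : F[X] :=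
  (List.ofFn fun i : Fin r => X - C (a i)).reverse.prod

/-- `a = (a₁, …, a_r)`, `r ≥ 1`, is a multiplicity sequence (for `σ = Id`, `δ = 0`) if `a₁` is the
only right zero of `(x - a_r) ⋯ (x - a₂) (x - a₁)`.  The entry `a₁` is `a 0`. -/
def IsMultiplicitySequence {F : Type*} [DivisionRing F] {r : ℕ} [NeZero r] (a : Fin r → F) :
    Prop :=
  {b : F | IsRightZero (linearProduct a) b} = {a 0}

open Quaternion

section DivisionRing

variable {F : Type*} [DivisionRing F]

/-! Write P = Q (x - a) with a = a₁. For b ≠ a, P(b) = Q(c)(b - a) with c the conjugate of b by b -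
a (`eval_mul_X_sub_C_of_conj`), so the other zeros of P come from zeros c of Q for which (b - a) b =
c (b - a) has a solution b ≠ a. There is one exactly when c is not conjugate to a, or c is the
conjugate quaternion of a nonreal a. Induction on r then reduces everything to consecutive pairs
(`isMultiplicitySequence_succ_iff`). -/

theorem exists_eq_mul_X_sub_C_add_C_eval (A : F[X]) (b : F) :
    ∃ G : F[X], A = G * (X - C b) + C (A.eval b) := by
  induction A using Polynomial.induction_on' with
  | add p q hp hq =>
    obtain ⟨G, hG⟩ := hp
    obtain ⟨H, hH⟩ := hq
    refine ⟨G + H, ?_⟩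
    rw [eval_add, C_add, add_mul]
    nth_rewrite 1 [hG, hH]
    abel
  | monomial n a =>
    have h := (commute_X (C b)).geom_sum₂_mul n
    refine ⟨C a * ∑ i ∈ Finset.range n, X ^ i * C b ^ (n - 1 - i), ?_⟩
    rw [mul_assoc, h, mul_sub, eval_monomial, C_mul, C_pow, sub_add_cancel,
      C_mul_X_pow_eq_monomial]

theorem isRightZero_iff_eval_eq_zero (A : F[X]) (b : F) : IsRightZero A b ↔ A.eval b = 0 := by
  constructor
  · rintro ⟨-, G, rfl⟩
    rw [add_zero, eval_mul_X_sub_C]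
  · intro h
    obtain ⟨G, hG⟩ := exists_eq_mul_X_sub_C_add_C_eval A b
    refine ⟨by simp [degree_X_sub_C], G, ?_⟩
    rw [h, C_0] at hG
    exact hG

/-- The product formula for evaluation at `b`, where `c` is the conjugate of `b` by `b - a`. -/
theorem eval_mul_X_sub_C_of_conj (G : F[X]) {a b c : F} (h : (b - a) * b = c * (b - a)) :
    (G * (X - C a)).eval b = G.eval c * (b - a) := by
  have hpow : ∀ n : ℕ, (b - a) * b ^ n = c ^ n * (b - a) := fun n =>
    (SemiconjBy.pow_right (show SemiconjBy (b - a) b c from h) n)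
  induction G using Polynomial.induction_on' with
  | add p q hp hq => rw [add_mul, eval_add, eval_add, hp, hq, add_mul]
  | monomial n g =>
    have e : (monomial n g : F[X]) * (X - C a) = monomial (n + 1) g - monomial n (g * a) := by
      rw [mul_sub, monomial_mul_X, monomial_mul_C]
    rw [e, eval_sub, eval_monomial, eval_monomial, eval_monomial, mul_assoc, mul_assoc g (c ^ n),
      ← hpow, pow_succ', ← mul_sub, ← sub_mul]

/-- On the solutions of a quadratic equation, evaluation of a polynomial is affine. -/
theorem exists_eval_eq_mul_add (Q : F[X]) (t n : F) :
    ∃ A B : F, ∀ b : F, b * b = t * b - n → Q.eval b = A * b + B := by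
  induction Q using Polynomial.induction_on' with
  | add p q hp hq =>
    obtain ⟨A, B, h⟩ := hp
    obtain ⟨A', B', h'⟩ := hq
    refine ⟨A + A', B + B', fun b hb => ?_⟩
    rw [eval_add, h b hb, h' b hb, add_mul]
    abel
  | monomial k g =>
    have key : ∃ A B : F, ∀ b : F, b * b = t * b - n → b ^ k = A * b + B := by
      induction k with
      | zero => exact ⟨0, 1, fun b _ => by simp⟩
      | succ k ih =>
        obtain ⟨A, B, h⟩ := ih
        refine ⟨A * t + B, -(A * n), fun b hb => ?_⟩
        rw [pow_succ, h b hb, add_mul, mul_assoc, hb, mul_sub, add_mul, mul_assoc]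
        abel
    obtain ⟨A, B, h⟩ := key
    refine ⟨g * A, g * B, fun b hb => ?_⟩
    rw [eval_monomial, h b hb, mul_add, mul_assoc]

theorem linearProduct_succ {r : ℕ} (a : Fin (r + 1) → F) :
    linearProduct a = linearProduct (fun i : Fin r => a i.succ) * (X - C (a 0)) := by
  simp [linearProduct, List.ofFn_succ]

theorem eval_linearProduct_zero {r : ℕ} (a : Fin (r + 1) → F) :
    (linearProduct a).eval (a 0) = 0 := by
  rw [linearProduct_succ, eval_mul_X_sub_C]

theorem isMultiplicitySequence_iff {r : ℕ} (a : Fin (r + 1) → F) :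
    IsMultiplicitySequence a ↔ ∀ b, (linearProduct a).eval b = 0 → b = a 0 := by
  unfold IsMultiplicitySequence
  simp only [isRightZero_iff_eval_eq_zero, Set.ext_iff, Set.mem_ofPred_eq, Set.mem_singleton_iff]
  refine ⟨fun h b => (h b).1, fun h b => ⟨h b, ?_⟩⟩
  rintro rfl
  exact eval_linearProduct_zero a

end DivisionRing

namespace Quaternion

theorem mul_self_eq (q : ℍ[ℝ]) :
    q * q = ((2 * q.re : ℝ) : ℍ[ℝ]) * q - ((‖q‖ * ‖q‖ : ℝ) : ℍ[ℝ]) := by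
  rw [← normSq_eq_norm_mul_self, ← star_mul_self, star_eq_two_re_sub, sub_mul, sub_sub_cancel]

theorem star_eq_self_iff_mem_range {q : ℍ[ℝ]} :
    star q = q ↔ q ∈ Set.range ((↑) : ℝ → ℍ[ℝ]) := by
  rw [star_eq_self]
  exact ⟨fun h => ⟨q.re, h.symm⟩, fun ⟨x, hx⟩ => by rw [← hx, re_coe]⟩

theorem eq_of_re_eq_of_norm_eq_of_star_eq_self {a b : ℍ[ℝ]} (hre : b.re = a.re)
    (hnorm : ‖b‖ = ‖a‖) (ha : star a = a) : b = a := by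
  have h : normSq b = normSq a := by
    rw [normSq_eq_norm_mul_self, normSq_eq_norm_mul_self, hnorm]
  rw [star_eq_self] at ha
  rw [ha, normSq_coe, normSq_def', hre] at h
  rw [ha]
  ext
  · simpa using hre
  all_goals simp only [imI_coe, imJ_coe, imK_coe]; nlinarith [sq_nonneg b.imI, sq_nonneg b.imJ,
    sq_nonneg b.imK]

theorem re_eq_and_norm_eq_of_mul_eq_mul {b c h : ℍ[ℝ]} (hh : h ≠ 0) (e : h * b = c * h) :
    b.re = c.re ∧ ‖b‖ = ‖c‖ := by
  constructor
  · have hb : b = h⁻¹ * (c * h) := by rw [← e, inv_mul_cancel_left₀ hh]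
    have hc : c = c * h * h⁻¹ := (mul_inv_cancel_right₀ hh c).symm
    have comm : ∀ x y : ℍ[ℝ], (x * y).re = (y * x).re := fun x y => by
      simp only [re_mul]; ring
    rw [hb, comm, ← hc]
  · have := congrArg norm e
    rw [norm_mul, norm_mul, mul_comm] at this
    exact mul_right_cancel₀ (norm_ne_zero_iff.2 hh) this

/-- If `a` is a root of the characteristic polynomial of `c`, then `a` is conjugate to `c`. -/
theorem re_eq_and_norm_eq_of_mul_self_eq {a c : ℍ[ℝ]}
    (h : a * a = ((2 * c.re : ℝ) : ℍ[ℝ]) * a - ((‖c‖ * ‖c‖ : ℝ) : ℍ[ℝ])) :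
    c.re = a.re ∧ ‖c‖ = ‖a‖ := by
  have h' := mul_self_eq a
  rw [h] at h'
  by_cases hre : c.re = a.re
  · refine ⟨hre, ?_⟩
    rw [hre, sub_right_inj, coe_inj] at h'
    exact (mul_self_inj (norm_nonneg _) (norm_nonneg _)).1 h'
  -- The two quadratics satisfied by a differ by a real-linear relation with nonzero leading
  -- coefficient, so a is real; then (a - Re c)² + |Im c|² = 0.
  · exfalso
    have hs : a.re - c.re ≠ 0 := sub_ne_zero.2 (Ne.symm hre)
    have hI : a.imI = 0 := by
      have := congrArg QuaternionAlgebra.imI h'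
      simp only [imI_sub, coe_mul_eq_smul, imI_smul, imI_coe, smul_eq_mul] at this
      exact (mul_eq_zero.1 (show (a.re - c.re) * a.imI = 0 by linarith)).resolve_left hs
    have hJ : a.imJ = 0 := by
      have := congrArg QuaternionAlgebra.imJ h'
      simp only [imJ_sub, coe_mul_eq_smul, imJ_smul, imJ_coe, smul_eq_mul] at this
      exact (mul_eq_zero.1 (show (a.re - c.re) * a.imJ = 0 by linarith)).resolve_left hs
    have hK : a.imK = 0 := by
      have := congrArg QuaternionAlgebra.imK h'
      simp only [imK_sub, coe_mul_eq_smul, imK_smul, imK_coe, smul_eq_mul] at this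
      exact (mul_eq_zero.1 (show (a.re - c.re) * a.imK = 0 by linarith)).resolve_left hs
    have := congrArg QuaternionAlgebra.re h
    rw [← normSq_eq_norm_mul_self, normSq_def'] at this
    simp only [re_sub, coe_mul_eq_smul, re_smul, re_coe, smul_eq_mul, re_mul, hI, hJ, hK] at this
    apply hs
    have : (a.re - c.re) ^ 2 = 0 := by
      nlinarith [sq_nonneg (a.re - c.re), sq_nonneg c.imI, sq_nonneg c.imJ, sq_nonneg c.imK]
    exact pow_eq_zero_iff two_ne_zero |>.1 this

/-- With k = (b - a)⁻¹ the equation becomes k c - a k = 1. The characteristic polynomial of c takes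
at a a nonzero value N commuting with a, and `star c - a` solves the equation with N in place of 1.
-/
theorem exists_ne_sub_mul_eq_mul_sub {a c : ℍ[ℝ]} (h : ¬(c.re = a.re ∧ ‖c‖ = ‖a‖)) :
    ∃ b, b ≠ a ∧ (b - a) * b = c * (b - a) := by
  set N : ℍ[ℝ] := a * a - (((2 * c.re : ℝ) : ℍ[ℝ]) * a - ((‖c‖ * ‖c‖ : ℝ) : ℍ[ℝ])) with hN
  have hN0 : N ≠ 0 := fun h0 => h (re_eq_and_norm_eq_of_mul_self_eq (sub_eq_zero.1 h0))
  have hNa : Commute N a :=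
    ((Commute.refl a).mul_left (Commute.refl a)).sub_left
      (((coe_commute _ a).mul_left (Commute.refl a)).sub_left (coe_commute _ a))
  have hs : star c - a ≠ 0 := fun h0 => h <| by
    rw [← sub_eq_zero.1 h0]
    simp
  -- the inverse of `b - a` solves a Sylvester equation
  set k : ℍ[ℝ] := N⁻¹ * (star c - a) with hk
  have hk0 : k ≠ 0 := mul_ne_zero (inv_ne_zero hN0) hs
  have hN' : (star c - a) * c - a * (star c - a) = N := by
    rw [hN, sub_mul, star_mul_self, normSq_eq_norm_mul_self, star_eq_two_re_sub, coe_commutes,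
      mul_sub, mul_sub]
    abel
  have hsyl : k * c - a * k = 1 := by
    rw [hk, ← mul_assoc a, ← (hNa.inv_left₀).eq, mul_assoc, mul_assoc, ← mul_sub, hN',
      inv_mul_cancel₀ hN0]
  refine ⟨a + k⁻¹, by simpa using hk0, ?_⟩
  rw [add_sub_cancel_left]
  have e : c = k⁻¹ * (a * k + 1) := by
    rw [← hsyl, add_sub_cancel, inv_mul_cancel_left₀ hk0]
  conv_rhs => rw [e]
  rw [mul_assoc, add_mul, mul_assoc, mul_inv_cancel₀ hk0, mul_one, one_mul]

/-- If b ≠ a, then b is conjugate to c, so a and b satisfy the same quadratic; subtracting gives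
`(star c - a) * (b - a) = 0`. -/
theorem eq_of_sub_mul_eq_mul_sub {a b c : ℍ[ℝ]} (hre : c.re = a.re) (hnorm : ‖c‖ = ‖a‖)
    (hc : star c ≠ a ∨ star a = a) (h : (b - a) * b = c * (b - a)) : b = a := by
  by_contra hb
  obtain ⟨hre', hnorm'⟩ := re_eq_and_norm_eq_of_mul_eq_mul (sub_ne_zero.2 hb) h
  rw [hre] at hre'
  rw [hnorm] at hnorm'
  rcases hc with hc | ha
  · have e : (star c - a) * (b - a) = 0 := by
      have h1 := mul_self_eq b
      have h2 := mul_self_eq a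
      rw [hre', hnorm'] at h1
      have h3 : star c = ((2 * a.re : ℝ) : ℍ[ℝ]) - c := by rw [star_eq_two_re_sub, hre]
      have h4 : (star c - a) * (b - a) =
          (((2 * a.re : ℝ) : ℍ[ℝ]) * b - ((‖a‖ * ‖a‖ : ℝ) : ℍ[ℝ]) - a * b - c * (b - a)) -
          (((2 * a.re : ℝ) : ℍ[ℝ]) * a - ((‖a‖ * ‖a‖ : ℝ) : ℍ[ℝ]) - a * a) := by
        rw [h3]; noncomm_ring
      rw [h4, ← h1, ← h2, ← sub_mul, h]
      simp
    rcases mul_eq_zero.1 e with e | e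
    · exact hc (sub_eq_zero.1 e)
    · exact hb (sub_eq_zero.1 e)
  · exact hb (eq_of_re_eq_of_norm_eq_of_star_eq_self hre' hnorm' ha)

end Quaternion

/-- The condition on consecutive entries `a`, `c` of a quaternionic multiplicity sequence. -/
def IsMultiplicityPair (a c : ℍ[ℝ]) : Prop :=
  c.re = a.re ∧ ‖c‖ = ‖a‖ ∧ (star c ≠ a ∨ star a = a)

theorem isMultiplicityPair_of_eval_eq_zero {Q : ℍ[ℝ][X]} {a c : ℍ[ℝ]}
    (hP : ∀ b, (Q * (X - C a)).eval b = 0 → b = a) (hc : Q.eval c = 0) :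
    IsMultiplicityPair a c := by
  have key : ∀ b, (b - a) * b = c * (b - a) → b = a := fun b hb =>
    hP b (by rw [eval_mul_X_sub_C_of_conj Q hb, hc, zero_mul])
  have hconj : c.re = a.re ∧ ‖c‖ = ‖a‖ := by
    by_contra h
    obtain ⟨b, hb, e⟩ := exists_ne_sub_mul_eq_mul_sub h
    exact hb (key b e)
  refine ⟨hconj.1, hconj.2, ?_⟩
  by_contra! h
  obtain ⟨h, ha⟩ := h
  apply ha
  rw [← h, star_star]
  rw [← h] at key
  refine key c ?_
  rw [sub_mul, mul_sub, star_comm_self' c]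

theorem isMultiplicitySequence_succ_iff {r : ℕ} (a : Fin (r + 2) → ℍ[ℝ]) :
    IsMultiplicitySequence a ↔
      IsMultiplicitySequence (fun i : Fin (r + 1) => a i.succ) ∧
        IsMultiplicityPair (a 0) (a 1) := by
  rw [isMultiplicitySequence_iff, isMultiplicitySequence_iff, linearProduct_succ a]
  have hQ := eval_linearProduct_zero fun i : Fin (r + 1) => a i.succ
  set Q := linearProduct fun i : Fin (r + 1) => a i.succ
  rw [Fin.succ_zero_eq_one] at hQ ⊢
  constructor
  · intro hP
    have hpair := isMultiplicityPair_of_eval_eq_zero hP hQ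
    refine ⟨fun c hc => ?_, hpair⟩
    have hpair' := isMultiplicityPair_of_eval_eq_zero hP hc
    by_contra hne
    -- Q is affine on the class of `a 0`, so two zeros there make it vanish on the whole class,
    -- including at `star (a 0)`. That forces `a 0` to be real and its class to be a single point.
    obtain ⟨A, B, hAB⟩ := exists_eval_eq_mul_add Q ((2 * (a 0).re : ℝ) : ℍ[ℝ])
      ((‖a 0‖ * ‖a 0‖ : ℝ) : ℍ[ℝ])
    have hclass : ∀ b : ℍ[ℝ], b.re = (a 0).re → ‖b‖ = ‖a 0‖ → Q.eval b = A * b + B :=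
      fun b h1 h2 => hAB b (by rw [mul_self_eq b, h1, h2])
    have e1 := hclass c hpair'.1 hpair'.2.1
    have e2 := hclass (a 1) hpair.1 hpair.2.1
    rw [hc] at e1
    rw [hQ] at e2
    have hA : A = 0 := by
      have : A * (c - a 1) = 0 := by
        rw [mul_sub, ← add_sub_add_right_eq_sub _ _ B, ← e1, ← e2, sub_zero]
      exact (mul_eq_zero.1 this).resolve_right (sub_ne_zero.2 hne)
    have hB : B = 0 := by simpa [hA] using e1.symm
    have hstar : Q.eval (star (a 0)) = 0 := by
      rw [hclass _ (by simp) (by simp), hA, hB, zero_mul, add_zero]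
    have hreal : star (a 0) = a 0 := by
      simpa using (isMultiplicityPair_of_eval_eq_zero hP hstar).2.2
    apply hne
    rw [eq_of_re_eq_of_norm_eq_of_star_eq_self hpair.1 hpair.2.1 hreal,
      eq_of_re_eq_of_norm_eq_of_star_eq_self hpair'.1 hpair'.2.1 hreal]
  · rintro ⟨hQu, hre, hnorm, hs⟩ b hb
    by_contra hne
    have hne' : b - a 0 ≠ 0 := sub_ne_zero.2 hne
    have e : (b - a 0) * b = (b - a 0) * b * (b - a 0)⁻¹ * (b - a 0) :=
      (inv_mul_cancel_right₀ hne' _).symm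
    rw [eval_mul_X_sub_C_of_conj Q e] at hb
    rw [hQu _ ((mul_eq_zero.1 hb).resolve_right hne')] at e
    exact hne (eq_of_sub_mul_eq_mul_sub hre hnorm hs e)

theorem isMultiplicitySequence_iff_forall_pair {r : ℕ} (a : Fin (r + 1) → ℍ[ℝ]) :
    IsMultiplicitySequence a ↔ ∀ i : Fin r, IsMultiplicityPair (a i.castSucc) (a i.succ) := by
  induction r with
  | zero =>
    rw [isMultiplicitySequence_iff, linearProduct_succ]
    simp [linearProduct, sub_eq_zero]
  | succ r ih =>
    rw [isMultiplicitySequence_succ_iff, ih, Fin.forall_fin_succ, and_comm]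
    rfl

theorem isMultiplicitySequence_const {r : ℕ} (a : ℍ[ℝ]) :
    IsMultiplicitySequence (fun _ : Fin (r + 1) => a) :=
  (isMultiplicitySequence_iff_forall_pair _).2 fun _ => ⟨rfl, rfl, ne_or_eq _ _⟩

theorem mainTheorem12 (r : ℕ) [NeZero r] :
    (∀ a : Fin r → Quaternion ℝ,
      IsMultiplicitySequence a ↔
        ((∀ i j : Fin r, a i = a j) ∧ ∀ i : Fin r, a i ∈ Set.range ((↑) : ℝ → Quaternion ℝ)) ∨
        ((∀ i : Fin r, a i ∉ Set.range ((↑) : ℝ → Quaternion ℝ)) ∧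
          ∀ i j : Fin r, (j : ℕ) = (i : ℕ) + 1 →
            (a j).re = (a i).re ∧ ‖a j‖ = ‖a i‖ ∧ star (a j) ≠ a i)) ∧
    ∀ a : Quaternion ℝ, IsMultiplicitySequence (fun _ : Fin r => a) := by
  obtain ⟨r, rfl⟩ := Nat.exists_eq_succ_of_ne_zero (NeZero.ne r)
  refine ⟨fun a => ?_, fun a => isMultiplicitySequence_const a⟩
  simp only [← star_eq_self_iff_mem_range]
  rw [isMultiplicitySequence_iff_forall_pair]
  constructor
  · intro h
    -- All entries share one conjugacy class, and a real class is a singleton: one real entry makes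
    -- the vector constant.
    by_cases h0 : star (a 0) = a 0
    · have key : ∀ i, a i = a 0 := fun i => by
        induction i using Fin.induction with
        | zero => rfl
        | succ i ih =>
          obtain ⟨hre, hnorm, -⟩ := h i
          rw [ih] at hre hnorm
          exact eq_of_re_eq_of_norm_eq_of_star_eq_self hre hnorm h0
      exact Or.inl ⟨fun i j => by rw [key i, key j], fun i => by rw [key i, h0]⟩
    · have key : ∀ i, star (a i) ≠ a i := fun i => by
        induction i using Fin.induction with
        | zero => exact h0
        | succ i ih =>
          obtain ⟨hre, hnorm, -⟩ := h i
          intro hi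
          rw [eq_of_re_eq_of_norm_eq_of_star_eq_self hre.symm hnorm.symm hi] at ih
          exact ih hi
      refine Or.inr ⟨key, fun i j hij => ?_⟩
      have hi : (i : ℕ) < r := by have := j.isLt; omega
      obtain ⟨hre, hnorm, hs⟩ := h ⟨i, hi⟩
      have ej : (⟨i, hi⟩ : Fin r).succ = j := Fin.ext hij.symm
      rw [ej] at hre hnorm hs
      exact ⟨hre, hnorm, hs.resolve_right (key _)⟩
  · rintro (⟨h, hreal⟩ | ⟨-, h⟩) i
    · rw [h i.succ i.castSucc]
      exact ⟨rfl, rfl, Or.inr (hreal _)⟩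
    · obtain ⟨hre, hnorm, hs⟩ := h i.castSucc i.succ (by simp)
      exact ⟨hre, hnorm, Or.inl hs⟩
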